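/- A division ring is called centrally finite if it is finite-dimensional over its center, and a division ring $D$ is called weakly locally finite if for every finite subset $S$ of $D$ the division subring of $D$ generated by $S$ is centrally finite. Let $D$ be a weakly locally finite division ring with center $F$, let $n \ge 2$, and let $N$ be an infinite subnormal subgroup of $GL_n(D)$. If $N$ is finitely generated, then $N$ consists of central scalar matrices, i.e. $N \subseteq F^*I = \{\alpha I : \alpha \in F,\ \alpha \neq 0\}$, where $I$ is the identity matrix. -/

import Mathlib

/-- A division ring `D` is centrally finite if it is a finite-dimensional vector space over its
center. -/
def IsCentrallyFinite (D : Type*) [DivisionRing D] : Prop :=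
  Module.Finite (Subring.center D) D

/-- A division ring `D` is weakly locally finite if, for every finite subset `S` of `D`, the
division subring of `D` generated by `S` is centrally finite (that is, finite-dimensional over its
own center). Mathlib's `Subfield D` is, for a division ring `D`, the type of division subrings. -/
def IsWeaklyLocallyFinite (D : Type*) [DivisionRing D] : Prop :=
  ∀ S : Set D, S.Finite → IsCentrallyFinite (Subfield.closure S)

/-! Suppose `N` has a noncentral element. `D` is infinite because `N` is, and an argument run down
the subnormal chain shows that `N` contains every transvection
(`Subgroup.IsSubnormal.vecTransvection_mem`). Since `N` is finitely generated, all entries of its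
elements lie in one finitely generated subring; the transvections `1 + x E_ij` put every `x` in it,
so `D` is a finitely generated ring. It is then centrally finite, and structure constants show that
its center is a finitely generated ring. By the Nullstellensatz over `ℤ` the center is a finite
field, so `D` is finite: a contradiction. -/

/-! ### Finitely generated division rings -/

/-- The ring of integers is a Jacobson ring. -/
theorem Int.isJacobsonRing : IsJacobsonRing ℤ := by
  rw [isJacobsonRing_iff_prime_eq]
  intro P hP
  by_cases h : P = ⊥
  · subst h
    refine le_antisymm (fun x hx => ?_) Ideal.le_jacobson
    rw [Ideal.mem_jacobson_bot] at hx
    -- The unit is `x * x + 1`, and `x * x + 1 = ±1` forces `x = 0`.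
    have h1 := Int.isUnit_iff.mp (hx x)
    rw [Ideal.mem_bot]
    rcases h1 with h1 | h1 <;> nlinarith
  · have := hP.isMaximal h
    exact Ideal.jacobson_eq_self_of_isMaximal

/-- A field that is finitely generated as a ring is finite. -/
theorem Field.finite_of_finiteType_int (K : Type*) [Field K] [Algebra.FiniteType ℤ K] :
    Finite K := by
  have := Int.isJacobsonRing
  have hfin : Module.Finite ℤ K := finite_of_finite_type_of_isJacobsonRing ℤ K
  obtain ⟨p, hp⟩ := CharP.exists K
  rcases CharP.char_is_prime_or_zero K p with hp' | rfl
  · have := Fact.mk hp'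
    let _ := ZMod.algebra K p
    have : Module.Finite (ZMod p) K := Module.Finite.of_restrictScalars_finite ℤ (ZMod p) K
    exact Module.finite_of_finite (ZMod p)
  · have := CharP.charP_to_charZero K
    have hinj : Function.Injective (algebraMap ℤ K) := by
      simpa using (Int.cast_injective (α := K))
    have : Algebra.IsIntegral ℤ K := inferInstance
    exact absurd (isField_of_isIntegral_of_isField hinj (Field.toIsField K)) Int.not_isField

/-- A centrally finite division ring that is finitely generated as a ring is finite. -/
theorem IsCentrallyFinite.finite_of_closure_eq_top {D : Type*} [DivisionRing D]
    (hD : IsCentrallyFinite D) {S : Set D} (hS : S.Finite) (hcl : Subring.closure S = ⊤) :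
    Finite D := by
  have : Module.Finite (Subring.center D) D := hD
  let b := Module.finBasis (Subring.center D) D
  set m := Module.finrank (Subring.center D) D
  -- Structure constants, coordinates of `1`, coordinates of the generators.
  let T : Set (Subring.center D) :=
    (Set.range fun q : Fin m × Fin m × Fin m => b.repr (b q.1 * b q.2.1) q.2.2) ∪
      (Set.range fun k => b.repr 1 k) ∪
      ((fun q : D × Fin m => b.repr q.1 q.2) '' (S ×ˢ Set.univ))
  have hT : T.Finite := ((Set.finite_range _).union (Set.finite_range _)).union
    ((hS.prod Set.finite_univ).image _)
  have key : ∀ x : D, ∀ k, b.repr x k ∈ Subring.closure T := by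
    intro x
    have hx : x ∈ Subring.closure S := hcl ▸ Subring.mem_top x
    induction hx using Subring.closure_induction with
    | mem x hx => exact fun k => Subring.subset_closure (Or.inr ⟨(x, k), ⟨hx, trivial⟩, rfl⟩)
    | zero => simp [zero_mem]
    | one => exact fun k => Subring.subset_closure (Or.inl (Or.inr ⟨k, rfl⟩))
    | add x y _ _ hx hy => intro k; simpa using add_mem (hx k) (hy k)
    | neg x _ hx => intro k; simpa using hx k
    | mul x y _ _ hx hy =>
      intro k
      have hxy : x * y = ∑ i, ∑ j, (b.repr x i * b.repr y j) • (b i * b j) := by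
        conv_lhs => rw [← b.sum_repr x, ← b.sum_repr y]
        rw [Finset.sum_mul_sum]
        refine Finset.sum_congr rfl fun i _ => Finset.sum_congr rfl fun j _ => ?_
        rw [smul_mul_smul_comm]
      rw [hxy]
      simp only [map_sum, map_smul, Finsupp.coe_finsetSum, Finset.sum_apply, Finsupp.smul_apply,
        smul_eq_mul]
      exact sum_mem fun i _ => sum_mem fun j _ => mul_mem (mul_mem (hx i) (hy j))
        (Subring.subset_closure (Or.inl (Or.inl ⟨(i, j, k), rfl⟩)))
  have hm : 0 < m := Module.finrank_pos
  have htop : Subring.closure T = ⊤ := by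
    refine eq_top_iff.mpr fun c _ => ?_
    simpa using key (c • b ⟨0, hm⟩) ⟨0, hm⟩
  have hft : Algebra.FiniteType ℤ (Subring.center D) := by
    refine ⟨⟨hT.toFinset, eq_top_iff.mpr fun x _ => ?_⟩⟩
    have hx : x ∈ Subring.closure T := htop ▸ Subring.mem_top x
    have hle : Subring.closure T ≤ (Algebra.adjoin ℤ T).toSubring :=
      Subring.closure_le.mpr Algebra.subset_adjoin
    simpa using hle hx
  have := Field.finite_of_finiteType_int (Subring.center D)
  exact Module.finite_of_finite (Subring.center D)

/-- A division ring that is finitely generated as a ring and isomorphic to a centrally finite one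
is finite. -/
theorem IsCentrallyFinite.finite_of_ringEquiv {D K : Type*} [DivisionRing D] [DivisionRing K]
    (e : D ≃+* K) (hK : IsCentrallyFinite K) {S : Set D} (hS : S.Finite)
    (hcl : Subring.closure S = ⊤) : Finite D := by
  have : Subring.closure (e '' S) = ⊤ := by
    have h := RingHom.map_closure (e : D →+* K) S
    rw [hcl, ← RingHom.range_eq_map, RingHom.range_eq_top.mpr e.surjective] at h
    exact h.symm
  have := hK.finite_of_closure_eq_top (hS.image e) this
  exact Finite.of_equiv K e.symm.toEquiv

/-- A weakly locally finite division ring that is finitely generated as a ring is finite. -/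
theorem IsWeaklyLocallyFinite.finite_of_closure_eq_top {D : Type*} [DivisionRing D]
    (hD : IsWeaklyLocallyFinite D) {S : Set D} (hS : S.Finite) (hcl : Subring.closure S = ⊤) :
    Finite D := by
  have htop : Subfield.closure S = ⊤ := by
    refine eq_top_iff.mpr fun x _ => ?_
    have hle : Subring.closure S ≤ (Subfield.closure S).toSubring :=
      Subring.closure_le.mpr Subfield.subset_closure
    exact hle (hcl ▸ Subring.mem_top x)
  have h := hD S hS
  rw [htop] at h
  exact h.finite_of_ringEquiv Subfield.topEquiv.symm hS hcl

open Matrix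

/-! ### Row vectors as functionals -/

section Separation

variable {ι D : Type*} [Fintype ι] [DivisionRing D]

theorem exists_dotProduct_eq_one {v : ι → D} (hv : v ≠ 0) : ∃ f : ι → D, f ⬝ᵥ v = 1 := by
  classical
  obtain ⟨i, hi⟩ := Function.ne_iff.mp hv
  exact ⟨Pi.single i (v i)⁻¹, by rw [single_dotProduct]; exact inv_mul_cancel₀ hi⟩

/-- Two right linearly independent vectors are separated by a row vector. -/
theorem exists_dotProduct_eq_zero_one {v w : ι → D} (hv : v ≠ 0)
    (hw : ∀ c : D, w ≠ MulOpposite.op c • v) : ∃ f : ι → D, f ⬝ᵥ v = 0 ∧ f ⬝ᵥ w = 1 := by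
  obtain ⟨k, hk⟩ := exists_dotProduct_eq_one hv
  obtain ⟨l, hl⟩ := exists_dotProduct_eq_one (sub_ne_zero.mpr (hw (k ⬝ᵥ w)))
  -- `l` is `1` on `w - v (k w)`; the correction by `k` makes it vanish on `v`.
  refine ⟨l - (l ⬝ᵥ v) • k, ?_, ?_⟩
  · simp [sub_dotProduct, smul_dotProduct, hk]
  · rw [dotProduct_sub, dotProduct_smul] at hl
    simpa [sub_dotProduct, smul_dotProduct] using hl

theorem exists_dotProduct_eq_one_right {f : ι → D} (hf : f ≠ 0) : ∃ v : ι → D, f ⬝ᵥ v = 1 := by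
  classical
  obtain ⟨i, hi⟩ := Function.ne_iff.mp hf
  exact ⟨Pi.single i (f i)⁻¹, by rw [dotProduct_single]; exact mul_inv_cancel₀ hi⟩

end Separation

/-! ### Transvections -/

section Transvections

variable {ι D : Type*} [Fintype ι] [DecidableEq ι] [DivisionRing D]

/-- The transvection `x ↦ x + v (f x)` attached to a column vector `v` and a row vector `f`
with `f v = 0`. -/
def vecTransvection (v f : ι → D) (h : f ⬝ᵥ v = 0) : GL ι D where
  val := 1 + vecMulVec v f
  inv := 1 - vecMulVec v f
  val_inv := by
    have : vecMulVec v f * vecMulVec v f = 0 := by simp [vecMulVec_mul_vecMulVec, h]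
    rw [add_mul, mul_sub, mul_sub, this]; simp
  inv_val := by
    have : vecMulVec v f * vecMulVec v f = 0 := by simp [vecMulVec_mul_vecMulVec, h]
    rw [sub_mul, mul_add, mul_add, this]; simp

theorem vecTransvection_mulVec (v f : ι → D) (h : f ⬝ᵥ v = 0) (x : ι → D) :
    (vecTransvection v f h).1 *ᵥ x = x + MulOpposite.op (f ⬝ᵥ x) • v := by
  simp [vecTransvection, add_mulVec, vecMulVec_mulVec]

theorem vecMul_vecTransvection_inv (v f : ι → D) (h : f ⬝ᵥ v = 0) (x : ι → D) :
    x ᵥ* (vecTransvection v f h)⁻¹.1 = x - (x ⬝ᵥ v) • f := by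
  change x ᵥ* (1 - vecMulVec v f) = _
  simp [vecMul_sub, vecMul_vecMulVec]

theorem vecTransvection_mul (v f g : ι → D) (hf : f ⬝ᵥ v = 0) (hg : g ⬝ᵥ v = 0) :
    vecTransvection v f hf * vecTransvection v g hg =
      vecTransvection v (f + g) (by rw [add_dotProduct, hf, hg, add_zero]) := by
  ext1
  simp [vecTransvection, add_mul, mul_add, vecMulVec_mul_vecMulVec, hf, vecMulVec_add]
  abel

theorem vecTransvection_conj (g : GL ι D) {v f v' f' : ι → D} (h : f ⬝ᵥ v = 0)
    (h' : f' ⬝ᵥ v' = 0) (hv : g.1 *ᵥ v = v') (hf : f ᵥ* g⁻¹.1 = f') :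
    g * vecTransvection v f h * g⁻¹ = vecTransvection v' f' h' := by
  ext1
  change g.1 * (1 + vecMulVec v f) * g⁻¹.1 = 1 + vecMulVec v' f'
  rw [mul_add, add_mul, mul_one, mul_vecMulVec, vecMulVec_mul, hv, hf]
  congr 1
  exact g.mul_inv

/-- A transvection that fixes `v` and moves the line of `w` to the line of `u`. -/
theorem exists_vecTransvection_fix_move {v w u : ι → D} (hv : v ≠ 0)
    (hw : ∀ c : D, w ≠ MulOpposite.op c • v) (hu : ∀ c : D, u ≠ MulOpposite.op c • v) :
    ∃ (x f : ι → D) (h : f ⬝ᵥ x = 0) (c : D), c ≠ 0 ∧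
      (vecTransvection x f h).1 *ᵥ v = v ∧
      (vecTransvection x f h).1 *ᵥ w = MulOpposite.op c • u := by
  obtain ⟨f, hfv, hfw, hfu⟩ : ∃ f : ι → D, f ⬝ᵥ v = 0 ∧ f ⬝ᵥ w = 1 ∧ f ⬝ᵥ u ≠ 0 := by
    obtain ⟨f, hfv, hfw⟩ := exists_dotProduct_eq_zero_one hv hw
    obtain ⟨g, hgv, hgu⟩ := exists_dotProduct_eq_zero_one hv hu
    by_cases h1 : f ⬝ᵥ u = 0
    · by_cases h2 : g ⬝ᵥ w = 0
      · exact ⟨f + g, by simp [add_dotProduct, hfv, hgv], by simp [add_dotProduct, hfw, h2],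
          by simp [add_dotProduct, h1, hgu]⟩
      · exact ⟨(g ⬝ᵥ w)⁻¹ • g, by simp [smul_dotProduct, hgv], by simp [smul_dotProduct, h2],
          by simp [smul_dotProduct, h2, hgu]⟩
    · exact ⟨f, hfv, hfw, h1⟩
  refine ⟨MulOpposite.op (f ⬝ᵥ u)⁻¹ • u - w, f, ?_, (f ⬝ᵥ u)⁻¹, inv_ne_zero hfu, ?_, ?_⟩
  · simp [dotProduct_sub, dotProduct_smul, hfw, hfu]
  · simp [vecTransvection_mulVec, hfv]
  · simp [vecTransvection_mulVec, hfw]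

/-- The subgroup generated by all transvections. -/
def transvectionSubgroup (ι D : Type*) [Fintype ι] [DecidableEq ι] [DivisionRing D] :
    Subgroup (GL ι D) :=
  Subgroup.closure {t | ∃ (v f : ι → D) (h : f ⬝ᵥ v = 0), t = vecTransvection v f h}

theorem vecTransvection_mem (v f : ι → D) (h : f ⬝ᵥ v = 0) :
    vecTransvection v f h ∈ transvectionSubgroup ι D :=
  Subgroup.subset_closure ⟨v, f, h, rfl⟩

/-- A product of transvections acting as `diag (a, a⁻¹)` on a plane containing `u` on which
`f` does not vanish. -/
theorem exists_diagonal_mem {u f : ι → D} (hu : u ≠ 0) (hf : f ≠ 0) (h : f ⬝ᵥ u = 0) {a : D}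
    (ha : a ≠ 0) : ∃ d ∈ transvectionSubgroup ι D,
      d.1 *ᵥ u = MulOpposite.op a • u ∧ f ᵥ* d⁻¹.1 = a • f := by
  obtain ⟨w, hw⟩ := exists_dotProduct_eq_one_right hf
  obtain ⟨k, hk⟩ := exists_dotProduct_eq_one hu
  obtain ⟨g, hgu, hgw⟩ : ∃ g : ι → D, g ⬝ᵥ u = 1 ∧ g ⬝ᵥ w = 0 :=
    ⟨k - (k ⬝ᵥ w) • f, by simp [sub_dotProduct, hk, h], by simp [sub_dotProduct, hw]⟩
  have hX : ∀ x : D, f ⬝ᵥ (MulOpposite.op x • u) = 0 := fun x => by simp [dotProduct_smul, h]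
  have hY : ∀ y : D, (y • g) ⬝ᵥ w = 0 := fun y => by simp [hgw]
  let X : D → GL ι D := fun x => vecTransvection (MulOpposite.op x • u) f (hX x)
  let Y : D → GL ι D := fun y => vecTransvection w (y • g) (hY y)
  have hXm : ∀ x, X x ∈ transvectionSubgroup ι D := fun x => vecTransvection_mem _ _ _
  have hYm : ∀ y, Y y ∈ transvectionSubgroup ι D := fun y => vecTransvection_mem _ _ _
  have hXv : ∀ x z, (X x).1 *ᵥ z = z + MulOpposite.op (f ⬝ᵥ z) • MulOpposite.op x • u :=
    fun x z => vecTransvection_mulVec _ _ _ _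
  have hYv : ∀ y z, (Y y).1 *ᵥ z = z + MulOpposite.op ((y • g) ⬝ᵥ z) • w :=
    fun y z => vecTransvection_mulVec _ _ _ _
  have hXf : ∀ x z, z ᵥ* (X x)⁻¹.1 = z - (z ⬝ᵥ (MulOpposite.op x • u)) • f :=
    fun x z => vecMul_vecTransvection_inv _ _ _ _
  have hYf : ∀ y z, z ᵥ* (Y y)⁻¹.1 = z - (z ⬝ᵥ w) • (y • g) :=
    fun y z => vecMul_vecTransvection_inv _ _ _ _
  clear_value X Y
  -- Whitehead's factorization of `diag (a, a⁻¹)`: on the plane of `u` and `w`, `X` and `Y` are the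
  -- upper and lower elementary matrices.
  refine ⟨X a * (Y (-a⁻¹) * (X a * (X (-1) * (Y 1 * X (-1))))), ?_, ?_, ?_⟩
  · exact mul_mem (hXm _) (mul_mem (hYm _) (mul_mem (hXm _) (mul_mem (hXm _)
      (mul_mem (hYm _) (hXm _)))))
  · have e1 : (X (-1)).1 *ᵥ u = u := by simp [hXv, h]
    have e2 : (Y 1).1 *ᵥ u = u + w := by simp [hYv, hgu]
    have e3 : (X (-1)).1 *ᵥ (u + w) = w := by simp [hXv, h, hw, dotProduct_add]
    have e4 : (X a).1 *ᵥ w = w + MulOpposite.op a • u := by simp [hXv, hw]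
    have e5 : (Y (-a⁻¹)).1 *ᵥ (w + MulOpposite.op a • u) = MulOpposite.op a • u := by
      simp [hYv, hgw, hgu, dotProduct_add, dotProduct_smul, ha]
    have e6 : (X a).1 *ᵥ (MulOpposite.op a • u) = MulOpposite.op a • u := by
      simp [hXv, h, dotProduct_smul]
    simp only [Units.val_mul, ← mulVec_mulVec, e1, e2, e3, e4, e5, e6]
  · have e1 : f ᵥ* (X (-1))⁻¹.1 = f := by simp [hXf, h]
    have e2 : f ᵥ* (Y 1)⁻¹.1 = f - g := by simp [hYf, hw]
    have e3 : (f - g) ᵥ* (X (-1))⁻¹.1 = -g := by simp [hXf, h, hgu, sub_dotProduct]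
    have e4 : (-g) ᵥ* (X a)⁻¹.1 = -g + a • f := by simp [hXf, dotProduct_smul, hgu]
    have e5 : (-g + a • f) ᵥ* (Y (-a⁻¹))⁻¹.1 = a • f := by
      simp [hYf, hgw, hw, add_dotProduct, smul_smul, ha]
    have e6 : (a • f) ᵥ* (X a)⁻¹.1 = a • f := by simp [hXf, dotProduct_smul, h]
    simp only [_root_.mul_inv_rev, Units.val_mul, ← vecMul_vecMul, e1, e2, e3, e4, e5, e6]

end Transvections

/-! ### Subnormal subgroups and transvections -/

section Subnormal

/-- Commutators of commuting elements modulo a normalized subgroup lie in that subgroup. -/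
theorem Subgroup.commutator_mem_of_mul_mem {G : Type*} [Group G] {N : Subgroup G}
    {n₁ a₁ n₂ a₂ : G} (h₁ : n₁ ∈ N) (h₂ : n₂ ∈ N) (hc : a₁ * a₂ = a₂ * a₁)
    (ha₁ : ∀ x ∈ N, a₁ * x * a₁⁻¹ ∈ N) (ha₂ : ∀ x ∈ N, a₂ * x * a₂⁻¹ ∈ N) :
    (n₁ * a₁) * (n₂ * a₂) * (n₁ * a₁)⁻¹ * (n₂ * a₂)⁻¹ ∈ N := by
  have hc' : a₁ * a₂ * a₁⁻¹ = a₂ := by rw [hc, mul_inv_cancel_right]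
  have : (n₁ * a₁) * (n₂ * a₂) * (n₁ * a₁)⁻¹ * (n₂ * a₂)⁻¹ =
      n₁ * (a₁ * n₂ * a₁⁻¹) * (a₁ * a₂ * a₁⁻¹ * n₁⁻¹ * a₂⁻¹) * n₂⁻¹ := by group
  rw [this, hc']
  exact mul_mem (mul_mem (mul_mem h₁ (ha₁ _ h₂)) (ha₂ _ (inv_mem h₁))) (inv_mem h₂)

variable {ι D : Type*} [Fintype ι] [DecidableEq ι] [DivisionRing D]

/-- A matrix that preserves every line of column vectors is a central scalar matrix. -/
theorem eq_scalar_of_forall_mulVec_mem_line [Nontrivial ι] (A : Matrix ι ι D)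
    (hA : ∀ v : ι → D, v ≠ 0 → ∃ c : D, A *ᵥ v = MulOpposite.op c • v) :
    ∃ c ∈ Subring.center D, A = Matrix.scalar ι c := by
  choose c hc using fun i : ι => hA (Pi.single i 1) (by simp)
  have hcol : ∀ i k, A k i = (Pi.single i (c i) : ι → D) k := by
    intro i k
    have := congrFun (hc i) k
    simpa [mulVec_single, Pi.single_apply] using this
  have key : ∀ i j, i ≠ j → ∀ x, c j * x = x * c i := by
    intro i j hij x
    have hne : (Pi.single i 1 + Pi.single j x : ι → D) ≠ 0 := fun h => by
      have := congrFun h i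
      simp [hij] at this
    obtain ⟨l, hl⟩ := hA _ hne
    have h1 := congrFun hl i
    have h2 := congrFun hl j
    simp [mulVec_add, mulVec_single, hcol, hij, hij.symm] at h1 h2
    rw [h1, h2]
  obtain ⟨i, j, hij⟩ := exists_pair_ne ι
  have hconst : ∀ k, c k = c i := fun k => by
    by_cases hk : i = k
    · rw [hk]
    · simpa using key i k hk 1
  refine ⟨c i, Subring.mem_center_iff.mpr fun x => ?_, ?_⟩
  · have := key i j hij x
    rw [hconst j] at this
    exact this.symm
  · ext k l
    rw [hcol, hconst, Matrix.scalar_apply, Matrix.diagonal_apply, Pi.single_apply]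

/-- A noncentral subgroup of `GL` that is normalized by the transvections contains all of them. -/
theorem vecTransvection_mem_of_normalized [Nontrivial ι] [Infinite D] {N : Subgroup (GL ι D)}
    (hN : ∀ k ∈ transvectionSubgroup ι D, ∀ x ∈ N, k * x * k⁻¹ ∈ N)
    {A : GL ι D} (hA : A ∈ N) (hnc : ¬ ∃ c ∈ Subring.center D, A.1 = Matrix.scalar ι c)
    (u f : ι → D) (h : f ⬝ᵥ u = 0) : vecTransvection u f h ∈ N := by
  obtain ⟨v, hv, hAv⟩ : ∃ v : ι → D, v ≠ 0 ∧ ∀ c : D, A.1 *ᵥ v ≠ MulOpposite.op c • v := by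
    by_contra! hcon
    exact hnc (eq_scalar_of_forall_mulVec_mem_line A.1 hcon)
  -- Conjugating `A` by a transvection that fixes `v` redirects the line of `A v` to that of `u`.
  have htrans : ∀ u : ι → D, u ≠ 0 → ∃ g ∈ N, ∃ c : D, g.1 *ᵥ v = MulOpposite.op c • u ∧ c ≠ 0 := by
    intro u hu
    by_cases huv : ∃ c : D, u = MulOpposite.op c • v
    · obtain ⟨c, rfl⟩ := huv
      have hc : c ≠ 0 := by rintro rfl; simp at hu
      exact ⟨1, one_mem _, c⁻¹, by simp [smul_smul, hc], inv_ne_zero hc⟩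
    · push Not at huv
      obtain ⟨x, f, hfx, c, hc, h1, h2⟩ := exists_vecTransvection_fix_move hv hAv huv
      refine ⟨_, hN _ (vecTransvection_mem x f hfx) A hA, c, ?_, hc⟩
      have h3 : (vecTransvection x f hfx)⁻¹.1 *ᵥ v = v := by
        conv_lhs => rw [← h1, mulVec_mulVec, Units.inv_mul, one_mulVec]
      rw [Units.val_mul, Units.val_mul, ← mulVec_mulVec, ← mulVec_mulVec, h3, h2]
  -- Modulo `N`, every transvection equals one along the fixed vector `v`; those commute with each
  -- other.
  have hmod : ∀ (u f : ι → D) (h : f ⬝ᵥ u = 0), u ≠ 0 → ∃ n ∈ N, ∃ (f' : ι → D)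
      (h' : f' ⬝ᵥ v = 0), vecTransvection u f h = n * vecTransvection v f' h' := by
    intro u f h hu
    obtain ⟨g, hg, c, hgc, hc⟩ := htrans u hu
    have hu' : u = MulOpposite.op c⁻¹ • g.1 *ᵥ v := by
      rw [hgc, smul_smul, ← MulOpposite.op_mul, mul_inv_cancel₀ hc, MulOpposite.op_one, one_smul]
    have h' : (c⁻¹ • (f ᵥ* g.1)) ⬝ᵥ v = 0 := by
      rw [smul_dotProduct, ← dotProduct_mulVec, hgc, dotProduct_smul, h, smul_zero, smul_zero]
    refine ⟨vecTransvection u f h * (vecTransvection v _ h')⁻¹, ?_, _, h', by group⟩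
    have hconj : g * vecTransvection v _ h' * g⁻¹ = vecTransvection u f h := by
      have h'' : (c⁻¹ • f) ⬝ᵥ (g.1 *ᵥ v) = 0 := by
        rw [hgc, smul_dotProduct, dotProduct_smul, h, smul_zero, smul_zero]
      rw [vecTransvection_conj g h' h'' rfl
        (by rw [smul_vecMul, vecMul_vecMul, Units.mul_inv, vecMul_one])]
      ext1
      ext i j
      simp [vecTransvection, hu', vecMulVec_apply, mul_assoc]
    rw [← hconj, mul_assoc, mul_assoc, ← mul_assoc _ g⁻¹]
    exact mul_mem hg (hN _ (vecTransvection_mem _ _ _) _ (inv_mem hg))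
  have hcomm : ∀ (u f : ι → D) (h : f ⬝ᵥ u = 0) (u' f' : ι → D) (h' : f' ⬝ᵥ u' = 0),
      u ≠ 0 → u' ≠ 0 → vecTransvection u f h * vecTransvection u' f' h' *
        (vecTransvection u f h)⁻¹ * (vecTransvection u' f' h')⁻¹ ∈ N := by
    intro u f h u' f' h' hu hu'
    obtain ⟨n, hn, k, hk, e⟩ := hmod u f h hu
    obtain ⟨n', hn', k', hk', e'⟩ := hmod u' f' h' hu'
    rw [e, e']
    refine Subgroup.commutator_mem_of_mul_mem hn hn' ?_ (hN _ (vecTransvection_mem _ _ _))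
      (hN _ (vecTransvection_mem _ _ _))
    simp only [vecTransvection_mul, add_comm]
  have hzero : ∀ (f : ι → D) (h : f ⬝ᵥ 0 = 0), vecTransvection 0 f h = 1 := by
    intro f h; ext1; simp [vecTransvection]
  by_cases hu : u = 0
  · subst hu; rw [hzero]; exact one_mem _
  by_cases hf : f = 0
  · have : vecTransvection u f h = 1 := by ext1; simp [vecTransvection, hf]
    rw [this]; exact one_mem _
  have hperf : ∀ k ∈ transvectionSubgroup ι D, ∀ (f : ι → D) (h : f ⬝ᵥ u = 0),
      k * vecTransvection u f h * k⁻¹ * (vecTransvection u f h)⁻¹ ∈ N := by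
    intro k hk f h
    induction hk using Subgroup.closure_induction with
    | mem k hk =>
      obtain ⟨w, g, hg, rfl⟩ := hk
      by_cases hw : w = 0
      · subst hw; rw [hzero]; simp
      · exact hcomm w g hg u f h hw hu
    | one => simp
    | mul a b ha _ iha ihb =>
      have := mul_mem (hN a ha _ ihb) iha
      convert this using 1
      group
    | inv a ha iha =>
      have := hN _ (inv_mem ha) _ (inv_mem iha)
      convert this using 1
      group
  -- The commutator of `diag (y, y⁻¹)` with the transvection of `x • f` is that of `(y * x * y - x)
  -- • f`. As `y * y ≠ 1`, some `x` makes this `y • f`.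
  have hscale : ∀ y : D, y ≠ 0 → y ≠ 1 → y ≠ -1 → ∀ hy : (y • f) ⬝ᵥ u = 0,
      vecTransvection u (y • f) hy ∈ N := by
    intro y hy0 hy1 hy2 hy
    obtain ⟨d, hd, hdu, hdf⟩ := exists_diagonal_mem hu hf h hy0
    have hne : y * y - 1 ≠ 0 := by
      rw [sub_ne_zero, Ne, mul_self_eq_one_iff]
      tauto
    let x := (y * y - 1)⁻¹ * y
    have hx : y * x * y - x = y := by
      have hcm : Commute y (y * y - 1)⁻¹ :=
        ((((Commute.refl y).mul_right (Commute.refl y)).sub_right (Commute.one_right y))).inv_right₀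
      have hxy : Commute y x := hcm.mul_right (Commute.refl y)
      have : y * x * y - x = (y * y - 1) * x := by
        rw [sub_mul, one_mul, mul_assoc y x y, ← hxy.eq, mul_assoc]
      rw [this, ← mul_assoc, mul_inv_cancel₀ hne, one_mul]
    have hsm : ∀ z : D, (z • f) ⬝ᵥ u = 0 := fun z => by rw [smul_dotProduct, h, smul_zero]
    have h1 := hperf d hd (x • f) (hsm x)
    have h2 : d * vecTransvection u (x • f) (hsm x) * d⁻¹ =
        vecTransvection u ((y * x * y) • f) (hsm _) := by
      rw [vecTransvection_conj d (hsm x) (v' := MulOpposite.op y • u) (f' := (x * y) • f)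
        (by rw [dotProduct_smul, hsm, smul_zero]) hdu (by rw [smul_vecMul, hdf, smul_smul])]
      ext1
      ext i j
      simp [vecTransvection, vecMulVec_apply, mul_assoc]
    have h3 : vecTransvection u (y • f) hy * vecTransvection u (x • f) (hsm x) =
        vecTransvection u ((y * x * y) • f) (hsm _) := by
      rw [vecTransvection_mul]
      congr 1
      rw [← add_smul]
      nth_rewrite 1 [← hx]
      rw [sub_add_cancel]
    rwa [h2, ← h3, mul_inv_cancel_right] at h1
  -- Split `f = y • f + (1 - y) • f`; excluding `2` keeps `1 - y ≠ -1`.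
  obtain ⟨y, hy⟩ := Infinite.exists_notMem_finset (α := D) (by classical exact {0, 1, -1, 2})
  simp only [Finset.mem_insert, Finset.mem_singleton, not_or] at hy
  obtain ⟨hy0, hy1, hy2, hy3⟩ := hy
  have hsm : ∀ z : D, (z • f) ⬝ᵥ u = 0 := fun z => by rw [smul_dotProduct, h, smul_zero]
  have h1 := hscale y hy0 hy1 hy2 (hsm y)
  have h2 := hscale (1 - y) (sub_ne_zero.mpr (Ne.symm hy1)) (by simpa using hy0)
    (fun hh => hy3 (by rw [← sub_sub_cancel 1 y, hh]; norm_num)) (hsm _)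
  have h3 := mul_mem h1 h2
  rw [vecTransvection_mul] at h3
  convert h3
  rw [← add_smul, add_sub_cancel, one_smul]

/-- A noncentral subnormal subgroup of `GL` over an infinite division ring contains all
transvections. -/
theorem Subgroup.IsSubnormal.vecTransvection_mem [Nontrivial ι] [Infinite D]
    {N : Subgroup (GL ι D)} (hsub : N.IsSubnormal) :
    ∀ {A : GL ι D}, A ∈ N → (¬ ∃ c ∈ Subring.center D, A.1 = Matrix.scalar ι c) →
      ∀ (u f : ι → D) (h : f ⬝ᵥ u = 0), vecTransvection u f h ∈ N := by
  induction hsub with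
  | top => intros; trivial
  | step H K hle _ hn ih =>
    intro A hA hnc
    -- By induction `K` contains the transvections, so they normalize `H`.
    have hK : transvectionSubgroup ι D ≤ K := by
      refine (Subgroup.closure_le _).mpr ?_
      rintro _ ⟨v, f, h, rfl⟩
      exact ih (hle hA) hnc v f h
    refine vecTransvection_mem_of_normalized (fun k hk x hx => ?_) hA hnc
    exact hn.conj_mem ⟨x, hle hx⟩ hx ⟨k, hK hk⟩

/-- The entries of the elements of a finitely generated subgroup of `GL` lie in a finitely
generated subring. -/
theorem Subgroup.FG.exists_finite_entries {N : Subgroup (GL ι D)} (hfg : N.FG) :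
    ∃ S : Set D, S.Finite ∧ ∀ A ∈ N, ∀ i j, A.1 i j ∈ Subring.closure S := by
  obtain ⟨T, rfl⟩ := hfg
  let S : Set D := (fun q : GL ι D × ι × ι => q.1.1 q.2.1 q.2.2) '' ((T : Set _) ×ˢ Set.univ) ∪
    (fun q : GL ι D × ι × ι => q.1⁻¹.1 q.2.1 q.2.2) '' ((T : Set _) ×ˢ Set.univ)
  have hS : S.Finite := ((T.finite_toSet.prod Set.finite_univ).image _).union
    ((T.finite_toSet.prod Set.finite_univ).image _)
  refine ⟨S, hS, fun A hA => ?_⟩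
  suffices h : (∀ i j, A.1 i j ∈ Subring.closure S) ∧ ∀ i j, A⁻¹.1 i j ∈ Subring.closure S from h.1
  have hone : ∀ i j, (1 : Matrix ι ι D) i j ∈ Subring.closure S := fun i j => by
    rw [Matrix.one_apply]; split_ifs
    exacts [one_mem _, zero_mem _]
  induction hA using Subgroup.closure_induction with
  | mem A hA =>
    exact ⟨fun i j => Subring.subset_closure (Or.inl ⟨(A, i, j), ⟨hA, trivial⟩, rfl⟩),
      fun i j => Subring.subset_closure (Or.inr ⟨(A, i, j), ⟨hA, trivial⟩, rfl⟩)⟩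
  | one => simpa using hone
  | mul A B _ _ hA hB =>
    simp only [_root_.mul_inv_rev, Units.val_mul, Matrix.mul_apply]
    exact ⟨fun i j => sum_mem fun k _ => mul_mem (hA.1 i k) (hB.1 k j),
      fun i j => sum_mem fun k _ => mul_mem (hB.2 i k) (hA.2 k j)⟩
  | inv A _ hA => rw [inv_inv]; exact hA.symm

end Subnormal

theorem theorem4p2 {D : Type*} [DivisionRing D] (hD : IsWeaklyLocallyFinite D)
    (n : ℕ) (hn : 2 ≤ n) (N : Subgroup (Matrix.GeneralLinearGroup (Fin n) D))
    (hsub : N.IsSubnormal) (hinf : Infinite N) (hfg : N.FG) :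
    ∀ A ∈ N, ∃ c ∈ Subring.center D, (A : Matrix (Fin n) (Fin n) D) = Matrix.scalar (Fin n) c := by
  have hDinf : Infinite D := by
    rw [← not_finite_iff_infinite]
    intro hfin
    have : Finite (GL (Fin n) D) := inferInstanceAs (Finite (Matrix (Fin n) (Fin n) D)ˣ)
    exact not_finite N
  have : Nontrivial (Fin n) := Fin.nontrivial_iff_two_le.mpr hn
  intro A hA
  by_contra hnc
  obtain ⟨S, hS, hent⟩ := hfg.exists_finite_entries
  have htop : Subring.closure S = ⊤ := by
    refine eq_top_iff.mpr fun x _ => ?_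
    obtain ⟨i, j, hij⟩ := exists_pair_ne (Fin n)
    have h : (Pi.single j 1 : Fin n → D) ⬝ᵥ Pi.single i x = 0 := by
      simp [hij.symm]
    have := hent _ (hsub.vecTransvection_mem hA hnc _ _ h) i j
    simpa [vecTransvection, vecMulVec_apply, hij] using this
  have := hD.finite_of_closure_eq_top hS htop
  exact not_finite D
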